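/- For $n\ge 0$ let $\mathcal D_n$ be the Dyck lattice of order $n$, i.e. the set of Dyck paths of semilength $n$ (lattice paths from $(0,0)$ to $(2n,0)$ with steps $(1,1)$ and $(1,-1)$ never going below the $x$-axis), partially ordered by $\gamma\le\gamma'$ if and only if $\gamma$ lies weakly below $\gamma'$. A saturated chain of length $h$ in a poset is a sequence $\gamma^{(0)}<\gamma^{(1)}<\cdots<\gamma^{(h)}$ in which each $\gamma^{(i+1)}$ covers $\gamma^{(i)}$. Let $sc_3(\mathcal D_n)$ be the number of saturated chains of length $3$ in $\mathcal D_n$. **Theorem.** As formal series in $x$ (where $\sqrt{1-4x}$ is the square root of $1-4x$ with constant term $1$), $$SC_3(x)=\sum_{n\ge 0} sc_3(\mathcal D_n)\,x^n=\frac{P(x)-Q(x)\sqrt{1-4x}}{x(1-4x)^3},$$ where $P(x)=1-13x+59x^2-100x^3+16x^4+64x^5=(1-4x)^3(1-x-x^2)$ and $Q(x)=1-11x+39x^2-40x^3-22x^4$. Moreover, for every $n\ge 2$, $$sc_3(\mathcal D_n)=\binom{2n}{n}\frac{(n^3-7n+2)(n-2)}{4(n+1)(2n-1)}.$$ -/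

import Mathlib

/-- A Dyck path of semilength `n`: a Dyck word (with `U = (1, 1)` and `D = (1, -1)`) having
`n` up steps. -/
@[ext]
structure DyckPath (n : ℕ) where
  word : DyckWord
  semilength_word : word.semilength = n

namespace DyckPath

/-- The ordinate of the path at the abscissa `i` (for `i ≤ 2 * n`): the number of up steps minus
the number of down steps among the first `i` steps. -/
def height {n : ℕ} (γ : DyckPath n) (i : ℕ) : ℤ :=
  ((γ.word.toList.take i).count DyckStep.U : ℤ) - ((γ.word.toList.take i).count DyckStep.D : ℤ)

theorem length_toList {n : ℕ} (γ : DyckPath n) : γ.word.toList.length = 2 * n := by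
  rw [← DyckWord.two_mul_semilength_eq_length, γ.semilength_word]

theorem height_succ {n : ℕ} (γ : DyckPath n) (i : ℕ) (hi : i < γ.word.toList.length) :
    γ.height (i + 1) = γ.height i + if γ.word.toList[i] = DyckStep.U then 1 else -1 := by
  unfold height
  rw [List.take_add_one, List.getElem?_eq_getElem hi]
  rcases DyckStep.dichotomy γ.word.toList[i] with h | h <;> simp [h] <;> ring

theorem height_injective {n : ℕ} {γ γ' : DyckPath n} (h : ∀ i, γ.height i = γ'.height i) :
    γ = γ' := by
  apply DyckPath.ext
  apply DyckWord.ext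
  apply List.ext_getElem
  · rw [length_toList, length_toList]
  · intro i h₁ h₂
    have e := h (i + 1)
    rw [height_succ γ i h₁, height_succ γ' i h₂, h i] at e
    rcases DyckStep.dichotomy γ.word.toList[i] with a | a <;>
      rcases DyckStep.dichotomy γ'.word.toList[i] with b | b <;> simp [a, b] at e ⊢

/-- Containment order on the Dyck paths of semilength `n`, which turns them into the Dyck lattice
of order `n`: `γ ≤ γ'` when `γ` lies weakly below `γ'`. -/
instance instPartialOrder (n : ℕ) : PartialOrder (DyckPath n) where
  le γ γ' := ∀ i, γ.height i ≤ γ'.height i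
  le_refl _ _ := le_rfl
  le_trans _ _ _ h₁ h₂ i := (h₁ i).trans (h₂ i)
  le_antisymm _ _ h₁ h₂ := height_injective fun i => le_antisymm (h₁ i) (h₂ i)

theorem le_iff {n : ℕ} (γ γ' : DyckPath n) : γ ≤ γ' ↔ ∀ i, γ.height i ≤ γ'.height i := Iff.rfl

instance instFinite (n : ℕ) : Finite (DyckPath n) :=
  Finite.of_injective
    (fun γ : DyckPath n => (⟨γ.word, γ.semilength_word⟩ : {p : DyckWord // p.semilength = n}))
    fun _ _ h => DyckPath.ext (congrArg Subtype.val h)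

end DyckPath

/-- A saturated chain `c 0 ⋖ c 1 ⋖ ⋯ ⋖ c h` of length `h` in a partially ordered set: each element
is covered by the next one. -/
def SaturatedChain (α : Type*) [PartialOrder α] (h : ℕ) : Type _ :=
  {c : Fin (h + 1) → α // ∀ i : Fin h, c i.castSucc ⋖ c i.succ}

instance SaturatedChain.instFinite (α : Type*) [PartialOrder α] [Finite α] (h : ℕ) :
    Finite (SaturatedChain α h) :=
  inferInstanceAs (Finite {c : Fin (h + 1) → α // ∀ i : Fin h, c i.castSucc ⋖ c i.succ})

/-- The number `sc_h` of saturated chains of length `h` of a finite partially ordered set. -/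
noncomputable def sc (h : ℕ) (α : Type*) [PartialOrder α] [Finite α] : ℕ :=
  Nat.card (SaturatedChain α h)

/-- The generating series `SC_h(x) = ∑ sc_h(𝒟_n) xⁿ`, as a formal power series. -/
noncomputable def SC (h : ℕ) : PowerSeries ℚ :=
  PowerSeries.mk fun n => (sc h (DyckPath n) : ℚ)

/-- The formal power series `√(1 - 4x)`, i.e. the binomial series `(1 + y) ^ (1/2)` at
`y = -4x`. -/
noncomputable def sqrtOneSubFourX : PowerSeries ℚ :=
  PowerSeries.rescale (-4 : ℚ) (PowerSeries.binomialSeries ℚ (1 / 2 : ℚ))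

/-- `sqrtOneSubFourX` is a square root of `1 - 4x`. -/
theorem sqrtOneSubFourX_sq : sqrtOneSubFourX ^ 2 = 1 - 4 * PowerSeries.X := by
  have h : PowerSeries.binomialSeries ℚ (1 / 2 : ℚ) ^ 2 = 1 + PowerSeries.X := by
    rw [sq, ← PowerSeries.binomialSeries_add]
    have := PowerSeries.binomialSeries_nat (R := ℚ) (A := ℚ) 1
    norm_num at this ⊢
    exact this
  rw [sqrtOneSubFourX, ← map_pow, h, map_add, map_one, PowerSeries.rescale_X]
  simp only [map_neg, map_ofNat]
  ring

/-- `sqrtOneSubFourX` is the square root of `1 - 4x` with constant term `1`. -/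
theorem constantCoeff_sqrtOneSubFourX : PowerSeries.constantCoeff sqrtOneSubFourX = 1 := by
  rw [sqrtOneSubFourX, ← PowerSeries.coeff_zero_eq_constantCoeff_apply, PowerSeries.coeff_rescale]
  simp

/-- The polynomial `P(x) = 1 - 13x + 59x² - 100x³ + 16x⁴ + 64x⁵`. -/
noncomputable def polyP : Polynomial ℚ :=
  1 - 13 * Polynomial.X + 59 * Polynomial.X ^ 2 - 100 * Polynomial.X ^ 3
    + 16 * Polynomial.X ^ 4 + 64 * Polynomial.X ^ 5

/-- The polynomial `Q(x) = 1 - 11x + 39x² - 40x³ - 22x⁴`. -/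
noncomputable def polyQ : Polynomial ℚ :=
  1 - 11 * Polynomial.X + 39 * Polynomial.X ^ 2 - 40 * Polynomial.X ^ 3 - 22 * Polynomial.X ^ 4

/-! In the Dyck lattice a cover turns one valley `DU` into a peak `UD`
(`covBy_iff_mem_valleyFlips`), so a saturated chain of length 3 is a path followed by three
successive valley flips. A flip removes its own valley and creates a new one for each neighbouring
letter that prolongs it (`D` before, `U` after). Iterating, the number of flip sequences from a word
is a polynomial in its numbers of factors `DU`, `DDU`, `DUU` and four factors of length 4
(`flipCount_three`).

To sum this over all Dyck paths, the first-return decomposition `U l D r` identifies Dyck words with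
binary trees. Each statistic is then additive up to indicators of how `l` ends and `r` begins, which
gives functional equations for the series of the moments. With `s = √(1 - 4x) = 1 - 2xc`, `c` the
Catalan series, each unknown moment occurs linearly in its own equation, so every series is a
rational function of `s` (`solve_valley_system`); this yields the closed form.

For the coefficients, let `b = 1/s` be the series of central binomial coefficients. Then `b'' = 12
b⁵`, and `Q s / (1 - 4x)³ = Q b⁵ = Q b'' / 12` has explicit coefficients. -/

open DyckStep BinaryTree PowerSeries

/-! ### Valley flips of words -/

/-- The lists obtained from `l` by replacing one factor `DU` (a valley) by `UD` (a peak). -/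
def valleyFlips : List DyckStep → List (List DyckStep)
  | [] => []
  | U :: t => (valleyFlips t).map (U :: ·)
  | [D] => []
  | D :: U :: t => (U :: D :: t) :: (valleyFlips (U :: t)).map (D :: ·)
  | D :: D :: t => (valleyFlips (D :: t)).map (D :: ·)

theorem mem_valleyFlips (l l' : List DyckStep) :
    l' ∈ valleyFlips l ↔ ∃ p q, l = p ++ D :: U :: q ∧ l' = p ++ U :: D :: q := by
  induction l using valleyFlips.induct generalizing l' with
  | case1 => simp [valleyFlips]
  | case2 t ih =>
    simp only [valleyFlips, List.mem_map, ih]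
    constructor
    · rintro ⟨_, ⟨p, q, rfl, rfl⟩, rfl⟩
      exact ⟨U :: p, q, rfl, rfl⟩
    · rintro ⟨_ | ⟨a, p⟩, q, h, rfl⟩
      · simp at h
      · simp only [List.cons_append, List.cons.injEq] at h
        exact ⟨_, ⟨p, q, h.2, rfl⟩, by simp [h.1]⟩
  | case3 =>
    simp only [valleyFlips, List.not_mem_nil, false_iff]
    rintro ⟨_ | ⟨a, _ | ⟨b, p⟩⟩, q, h, -⟩ <;> simp at h
  | case4 t ih =>
    rw [valleyFlips]
    simp only [List.mem_cons, List.mem_map, ih]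
    constructor
    · rintro (rfl | ⟨_, ⟨p, q, h, rfl⟩, rfl⟩)
      · exact ⟨[], t, rfl, rfl⟩
      · exact ⟨D :: p, q, by simp [h], rfl⟩
    · rintro ⟨_ | ⟨a, p⟩, q, h, rfl⟩
      · simp at h
        simp [h]
      · simp only [List.cons_append, List.cons.injEq] at h
        exact Or.inr ⟨_, ⟨p, q, h.2, rfl⟩, by simp [h.1]⟩
  | case5 t ih =>
    simp only [valleyFlips, List.mem_map, ih]
    constructor
    · rintro ⟨_, ⟨p, q, h, rfl⟩, rfl⟩
      exact ⟨D :: p, q, by simp [h], rfl⟩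
    · rintro ⟨_ | ⟨a, p⟩, q, h, rfl⟩
      · simp at h
      · simp only [List.cons_append, List.cons.injEq] at h
        exact ⟨_, ⟨p, q, h.2, rfl⟩, by simp [h.1]⟩

theorem nodup_valleyFlips (l : List DyckStep) : (valleyFlips l).Nodup := by
  induction l using valleyFlips.induct with
  | case1 => simp [valleyFlips]
  | case2 t ih => exact ih.map (List.cons_injective)
  | case3 => simp [valleyFlips]
  | case4 t ih => exact List.nodup_cons.2 ⟨by simp, ih.map (List.cons_injective)⟩
  | case5 t ih => exact ih.map (List.cons_injective)

/-- The sum of `f` over the lists obtained from `l` by flipping one valley. -/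
def flipSum (f : List DyckStep → ℚ) (l : List DyckStep) : ℚ := ((valleyFlips l).map f).sum

/-- The number of sequences of `h` successive valley flips starting from `l`. -/
def flipCount : ℕ → List DyckStep → ℚ
  | 0 => fun _ => 1
  | h + 1 => flipSum (flipCount h)

/-! ### Covers in the Dyck lattice -/

namespace DyckPath

variable {n : ℕ}

theorem height_of_valley {γ γ' : DyckPath n} {p q : List DyckStep}
    (h : γ.word.toList = p ++ D :: U :: q) (h' : γ'.word.toList = p ++ U :: D :: q) (i : ℕ) :
    γ'.height i = γ.height i + if i = p.length + 1 then 2 else 0 := by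
  unfold height
  rw [h, h', List.take_append, List.take_append]
  rcases Nat.lt_trichotomy i (p.length + 1) with hi | rfl | hi
  · rw [Nat.sub_eq_zero_of_le (by omega), if_neg hi.ne]
    simp
  · simp
    ring
  · obtain ⟨k, rfl⟩ := Nat.exists_eq_add_of_lt hi
    rw [if_neg hi.ne', show p.length + 1 + k + 1 - p.length = k + 2 by omega]
    simp

theorem height_zero (γ : DyckPath n) : γ.height 0 = 0 := by simp [height]

theorem height_of_length_le (γ : DyckPath n) {i : ℕ} (hi : 2 * n ≤ i) : γ.height i = 0 := by
  have := γ.word.count_U_eq_count_D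
  rw [height, List.take_of_length_le (by rwa [length_toList]), this, sub_self]

theorem even_height_add (γ : DyckPath n) {i : ℕ} (hi : i ≤ 2 * n) : Even (γ.height i + i) := by
  induction i with
  | zero => simp [height_zero]
  | succ i ih =>
    have := ih (by omega)
    rw [height_succ γ i (by rw [length_toList]; omega)]
    split_ifs
    · obtain ⟨k, hk⟩ := this
      exact ⟨k + 1, by push_cast; omega⟩
    · obtain ⟨k, hk⟩ := this
      exact ⟨k, by push_cast; omega⟩

/-- Parity makes any strict gap between two paths at least 2, exactly the height of a valley flip.
-/
theorem even_height_sub (γ γ' : DyckPath n) (i : ℕ) : Even (γ'.height i - γ.height i) := by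
  by_cases hi : i ≤ 2 * n
  · obtain ⟨a, ha⟩ := γ.even_height_add hi
    obtain ⟨b, hb⟩ := γ'.even_height_add hi
    exact ⟨b - a, by omega⟩
  · simp [height_of_length_le _ (not_le.1 hi).le]

/-- A Dyck path remains one when a valley is turned into a peak. -/
theorem exists_word_of_valley (γ : DyckPath n) {p q : List DyckStep}
    (h : γ.word.toList = p ++ D :: U :: q) :
    ∃ γ' : DyckPath n, γ'.word.toList = p ++ U :: D :: q := by
  have hU := γ.semilength_word
  have hD := γ.word.count_U_eq_count_D
  rw [DyckWord.semilength, h] at hU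
  rw [h] at hD
  simp only [List.count_append, List.count_cons_self, ne_eq, reduceCtorEq, not_false_eq_true,
    List.count_cons_of_ne] at hU hD
  refine ⟨⟨⟨p ++ U :: D :: q, ?_, fun i => ?_⟩, ?_⟩, rfl⟩
  · simp only [List.count_append, List.count_cons_self, ne_eq, reduceCtorEq, not_false_eq_true,
      List.count_cons_of_ne]
    omega
  · have := γ.word.count_D_le_count_U i
    rw [h, List.take_append] at this
    rw [List.take_append]
    generalize i - p.length = k at this ⊢
    rcases k with _ | _ | k <;> simp at this ⊢ <;> omega
  · simp only [DyckWord.semilength, List.count_append, List.count_cons_self, ne_eq, reduceCtorEq,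
      not_false_eq_true, List.count_cons_of_ne]
    omega

/-- The two paths differ at a single abscissa, by 2; a path in between has, by parity, one of the
two extreme ordinates there. -/
theorem covBy_of_mem_valleyFlips {γ γ' : DyckPath n}
    (h : γ'.word.toList ∈ valleyFlips γ.word.toList) : γ ⋖ γ' := by
  obtain ⟨p, q, h, h'⟩ := (mem_valleyFlips _ _).1 h
  have hh := height_of_valley h h'
  refine ⟨lt_of_le_of_ne (fun i => ?_) ?_, fun δ h₁ h₂ => ?_⟩
  · rw [hh]; split_ifs <;> omega
  · rintro rfl
    simpa using hh (p.length + 1)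
  · have l₁ := (le_iff _ _).1 h₁.le
    have l₂ := (le_iff _ _).1 h₂.le
    obtain ⟨k, hk⟩ := even_height_sub γ δ (p.length + 1)
    have e := hh (p.length + 1)
    rw [if_pos rfl] at e
    have a₁ := l₁ (p.length + 1)
    have a₂ := l₂ (p.length + 1)
    by_cases hc : δ.height (p.length + 1) = γ.height (p.length + 1)
    · refine h₁.ne (height_injective fun i => ?_)
      have b₁ := l₁ i
      have b₂ := l₂ i
      rw [hh i] at b₂
      split_ifs at b₂ with hi
      · rw [hi, hc]
      · omega
    · refine h₂.ne (height_injective fun i => ?_)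
      have b₁ := l₁ i
      have b₂ := l₂ i
      have := hh i
      split_ifs at this with hi
      · subst hi; omega
      · omega

/-- Below a larger path there is a valley flip of the smaller one. -/
theorem exists_valley_of_lt {γ γ' : DyckPath n} (h : γ < γ') :
    ∃ δ : DyckPath n, δ.word.toList ∈ valleyFlips γ.word.toList ∧ δ ≤ γ' := by
  have hle := (le_iff _ _).1 h.le
  have hS : ∀ i, γ.height i < γ'.height i → 0 < i ∧ i < 2 * n := by
    intro i hi
    constructor
    · rcases Nat.eq_zero_or_pos i with rfl | h0
      · simp [height_zero] at hi
      · exact h0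
    · by_contra hn
      simp [height_of_length_le _ (not_lt.1 hn)] at hi
  obtain ⟨i₀, hi₀⟩ : ∃ i, γ.height i < γ'.height i := by
    by_contra! hc
    exact h.ne (height_injective fun i => le_antisymm (hle i) (hc i))
  -- At a lowest point of `γ` among those strictly below `γ'` there is a valley: a neighbouring
  -- point of smaller ordinate would again be strictly below `γ'`, whose steps change the ordinate
  -- by only 1.
  obtain ⟨i, hi, hmin⟩ := Finset.exists_min_image
    ((Finset.range (2 * n)).filter fun i => γ.height i < γ'.height i) γ.height
    ⟨i₀, by simp [hi₀, (hS i₀ hi₀).2]⟩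
  simp only [Finset.mem_filter, Finset.mem_range, and_imp] at hi hmin
  obtain ⟨hi2, hi⟩ := hi
  obtain ⟨j, rfl⟩ := Nat.exists_eq_add_of_lt (hS i hi).1
  simp only [zero_add] at hi hi2 hmin
  have hmin' : ∀ k, γ.height k < γ'.height k → γ.height (j + 1) ≤ γ.height k :=
    fun k hk => hmin k (hS k hk).2 hk
  have lt₁ : j < γ.word.toList.length := by rw [length_toList]; omega
  have lt₂ : j + 1 < γ.word.toList.length := by rw [length_toList]; omega
  have lt₁' : j < γ'.word.toList.length := by rw [length_toList]; omega
  have lt₂' : j + 1 < γ'.word.toList.length := by rw [length_toList]; omega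
  have hD : γ.word.toList[j] = D := by
    rcases DyckStep.dichotomy γ.word.toList[j] with e | e
    · have h₁ := height_succ γ j lt₁
      have h₂ := height_succ γ' j lt₁'
      rw [if_pos e] at h₁
      have := hmin' j (by split_ifs at h₂ <;> omega)
      omega
    · exact e
  have hU : γ.word.toList[j + 1] = U := by
    rcases DyckStep.dichotomy γ.word.toList[j + 1] with e | e
    · exact e
    · have h₁ := height_succ γ (j + 1) lt₂
      have h₂ := height_succ γ' (j + 1) lt₂'
      rw [e, if_neg (by simp)] at h₁
      have := hmin' (j + 1 + 1) (by split_ifs at h₂ <;> omega)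
      omega
  have hw : γ.word.toList =
      γ.word.toList.take j ++ D :: U :: γ.word.toList.drop (j + 1 + 1) := by
    conv_lhs => rw [← List.take_append_drop j γ.word.toList, List.drop_eq_getElem_cons lt₁,
      List.drop_eq_getElem_cons lt₂, hD, hU]
  obtain ⟨δ, hδ⟩ := exists_word_of_valley γ hw
  refine ⟨δ, (mem_valleyFlips _ _).2 ⟨_, _, hw, hδ⟩, fun k => ?_⟩
  rw [height_of_valley hw hδ, List.length_take, min_eq_left lt₁.le]
  split_ifs with hk
  · subst hk
    -- By parity the gap at the valley is at least 2, so the flipped path still lies below `γ'`.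
    obtain ⟨m, hm⟩ := even_height_sub γ γ' (j + 1)
    omega
  · simpa using hle k

/-- In the Dyck lattice, covering a path means flipping one of its valleys. -/
theorem covBy_iff_mem_valleyFlips {γ γ' : DyckPath n} :
    γ ⋖ γ' ↔ γ'.word.toList ∈ valleyFlips γ.word.toList := by
  refine ⟨fun h => ?_, covBy_of_mem_valleyFlips⟩
  obtain ⟨δ, hδ, hle⟩ := exists_valley_of_lt h.lt
  rcases hle.eq_or_lt with rfl | hlt
  · exact hδ
  · exact absurd hlt (h.2 (covBy_of_mem_valleyFlips hδ).lt)

noncomputable instance instFintype (n : ℕ) : Fintype (DyckPath n) := Fintype.ofFinite _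

-- Distinct flips give distinct words, so a sum over upper covers becomes a sum over a recursively
-- defined list.
open Classical in
theorem sum_covBy (γ : DyckPath n) (f : List DyckStep → ℚ) :
    ∑ γ' with γ ⋖ γ', f γ'.word.toList = flipSum f γ.word.toList := by
  rw [flipSum, ← List.sum_toFinset f (nodup_valleyFlips _)]
  refine Finset.sum_bij (fun δ _ => δ.word.toList) ?_ ?_ ?_ fun _ _ => rfl
  · intro δ hδ
    simpa [covBy_iff_mem_valleyFlips] using hδ
  · intro δ₁ _ δ₂ _ h
    exact DyckPath.ext (DyckWord.ext h)
  · intro l hl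
    rw [List.mem_toFinset] at hl
    obtain ⟨p, q, h, rfl⟩ := (mem_valleyFlips _ _).1 hl
    obtain ⟨δ, hδ⟩ := exists_word_of_valley γ h
    exact ⟨δ, by simpa [covBy_iff_mem_valleyFlips, hδ] using hl, hδ⟩

end DyckPath

/-! ### Counting chains from their bottom element -/

namespace SaturatedChain

variable {α : Type*} [PartialOrder α]

/-- A saturated chain of positive length starting at `a` is a cover of `a` followed by a saturated
chain that starts there. -/
def consEquiv (h : ℕ) (a : α) :
    {c : SaturatedChain α (h + 1) // c.1 0 = a} ≃
      Σ b : {b : α // a ⋖ b}, {c : SaturatedChain α h // c.1 0 = b.1} where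
  toFun c := ⟨⟨c.1.1 1, by simpa [c.2] using c.1.2 0⟩,
    ⟨⟨fun i => c.1.1 i.succ, fun i => by simpa using c.1.2 i.succ⟩, rfl⟩⟩
  invFun x := ⟨⟨Fin.cons a x.2.1.1, fun i => by
    refine Fin.cases ?_ (fun i => ?_) i
    · simpa [x.2.2] using x.1.2
    · simpa using x.2.1.2 i⟩, rfl⟩
  left_inv c := by
    apply Subtype.ext
    apply Subtype.ext
    funext i
    refine Fin.cases ?_ (fun i => ?_) i
    · simp [c.2]
    · simp
  right_inv := by
    rintro ⟨⟨b, hb⟩, ⟨c, hc⟩, h⟩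
    change c 0 = b at h
    subst h
    rfl

open Classical in
theorem card_cons [Fintype α] (h : ℕ) (a : α) :
    Nat.card {c : SaturatedChain α (h + 1) // c.1 0 = a} =
      ∑ b with a ⋖ b, Nat.card {c : SaturatedChain α h // c.1 0 = b} := by
  rw [Nat.card_congr (consEquiv h a), Nat.card_sigma]
  exact (Finset.sum_subtype (Finset.univ.filter (a ⋖ ·)) (by simp)
    fun b => Nat.card {c : SaturatedChain α h // c.1 0 = b}).symm

theorem card_zero (a : α) : Nat.card {c : SaturatedChain α 0 // c.1 0 = a} = 1 := by
  rw [Nat.card_eq_one_iff_unique]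
  refine ⟨⟨fun c d => ?_⟩, ⟨⟨⟨fun _ => a, fun i => i.elim0⟩, rfl⟩⟩⟩
  apply Subtype.ext
  apply Subtype.ext
  funext i
  rw [Fin.fin_one_eq_zero i]
  exact c.2.trans d.2.symm

end SaturatedChain

theorem DyckPath.card_saturatedChain {n : ℕ} (h : ℕ) (γ : DyckPath n) :
    (Nat.card {c : SaturatedChain (DyckPath n) h // c.1 0 = γ} : ℚ) =
      flipCount h γ.word.toList := by
  induction h generalizing γ with
  | zero => simp [SaturatedChain.card_zero, flipCount]
  | succ h ih =>
    rw [SaturatedChain.card_cons, Nat.cast_sum, flipCount, ← DyckPath.sum_covBy]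
    exact Finset.sum_congr rfl fun δ _ => ih δ

theorem sc_eq_sum_flipCount (h n : ℕ) :
    (sc h (DyckPath n) : ℚ) = ∑ γ : DyckPath n, flipCount h γ.word.toList := by
  rw [sc, Nat.card_congr (Equiv.sigmaFiberEquiv fun c : SaturatedChain (DyckPath n) h => c.1 0).symm,
    Nat.card_sigma, Nat.cast_sum]
  exact Finset.sum_congr rfl fun γ _ => DyckPath.card_saturatedChain h γ

/-! ### Factor counts summed over valley flips -/

/-- `1` if the list `l` starts with `w`, and `0` otherwise. -/
def startsWith (w l : List DyckStep) : ℚ := if w <+: l then 1 else 0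

/-- `1` if the list `l` ends with `w`, and `0` otherwise. -/
def endsWith (w l : List DyckStep) : ℚ := if w <:+ l then 1 else 0

/-- The number of occurrences of the nonempty list `w` as a factor of a list. -/
def factorCount (w : List DyckStep) : List DyckStep → ℚ
  | [] => 0
  | a :: t => startsWith w (a :: t) + factorCount w t

section StartsWith

variable (a b : DyckStep) (w l : List DyckStep)

@[simp]
theorem startsWith_nil_left : startsWith [] l = 1 := by simp [startsWith]

@[simp]
theorem startsWith_nil_right : startsWith (a :: w) [] = 0 := by simp [startsWith]

@[simp]
theorem startsWith_cons :
    startsWith (a :: w) (b :: l) = if a = b then startsWith w l else 0 := by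
  by_cases h : a = b <;> simp [startsWith, List.cons_prefix_cons, h]

theorem startsWith_sq : startsWith w l ^ 2 = startsWith w l := by
  unfold startsWith
  split_ifs <;> norm_num

@[simp]
theorem factorCount_nil : factorCount w [] = 0 := rfl

@[simp]
theorem factorCount_cons :
    factorCount w (a :: l) = startsWith w (a :: l) + factorCount w l := rfl

end StartsWith

section FlipSum

variable (f g : List DyckStep → ℚ) (t : List DyckStep)

@[simp]
theorem flipSum_nil : flipSum f [] = 0 := by simp [flipSum, valleyFlips]

@[simp]
theorem flipSum_U : flipSum f (U :: t) = flipSum (fun l => f (U :: l)) t := by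
  simp [flipSum, valleyFlips, Function.comp_def]

@[simp]
theorem flipSum_D : flipSum f [D] = 0 := by simp [flipSum, valleyFlips]

@[simp]
theorem flipSum_DU :
    flipSum f (D :: U :: t) = f (U :: D :: t) + flipSum (fun l => f (D :: U :: l)) t := by
  simp [flipSum, valleyFlips, Function.comp_def]

@[simp]
theorem flipSum_DD :
    flipSum f (D :: D :: t) = flipSum (fun l => f (D :: l)) (D :: t) := by
  simp [flipSum, valleyFlips, Function.comp_def]

@[simp]
theorem flipSum_add : flipSum (fun l => f l + g l) t = flipSum f t + flipSum g t := by
  simp [flipSum, List.sum_map_add]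

theorem flipSum_mul_left (c : ℚ) : flipSum (fun l => c * f l) t = c * flipSum f t := by
  simp [flipSum, List.sum_map_mul_left]

end FlipSum

theorem flipSum_one (l : List DyckStep) : flipSum (fun _ => 1) l = factorCount [D, U] l := by
  induction l using valleyFlips.induct <;> simp_all

@[simp]
theorem flipSum_const (c : ℚ) (l : List DyckStep) :
    flipSum (fun _ => c) l = c * factorCount [D, U] l := by
  rw [← flipSum_one, ← flipSum_mul_left]
  simp

-- This and the next three lemmas are boundary terms for the inductions below: peeling off a first
-- letter leaves prefix indicators of the rest, which a flip at its head can change.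
@[simp]
theorem flipSum_startsWith_U (t : List DyckStep) :
    flipSum (fun l => startsWith [U] l) (D :: t) = startsWith [U] t := by
  rcases t with _ | ⟨_ | _, t⟩ <;> simp

@[simp]
theorem flipSum_startsWith_UU (t : List DyckStep) :
    flipSum (fun l => startsWith [U, U] l) (D :: t) = 0 := by
  rcases t with _ | ⟨_ | _, t⟩ <;> simp

@[simp]
theorem flipSum_startsWith_DU (t : List DyckStep) :
    flipSum (fun l => startsWith [D, U] l) (D :: t) =
      startsWith [U] t * factorCount [D, U] t + startsWith [D, U] t := by
  rcases t with _ | ⟨_ | _, t⟩ <;> simp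

@[simp]
theorem flipSum_startsWith_U_mul_valleys (t : List DyckStep) :
    flipSum (fun l => startsWith [U] l * factorCount [D, U] l) (D :: t) =
      startsWith [U] t * factorCount [D, U] t + startsWith [U, U] t := by
  rcases t with _ | ⟨_ | _, t⟩ <;> simp [add_comm]

/-- The number of valleys summed over the valley flips of a list. -/
theorem flipSum_valleys (l : List DyckStep) :
    flipSum (fun l => factorCount [D, U] l) l =
      factorCount [D, U] l ^ 2 - factorCount [D, U] l + factorCount [D, D, U] l
        + factorCount [D, U, U] l := by
  -- A flip keeps the other valleys, and creates one if `D` precedes (`DDU` becomes `DUD`) and one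
  -- if `U` follows (`DUU` becomes `UDU`).
  induction l using valleyFlips.induct with
  | case1 => simp
  | case2 t ih => simp [ih]
  | case3 => simp
  | case4 t ih =>
    rcases t with _ | ⟨_ | _, t⟩ <;> simp at ih ⊢ <;> linear_combination ih
  | case5 t ih =>
    rcases t with _ | ⟨_ | _, t⟩ <;> simp at ih ⊢ <;> linear_combination ih

/-- The squared number of valleys summed over the valley flips of a list. -/
theorem flipSum_valleys_sq (l : List DyckStep) :
    flipSum (fun l => factorCount [D, U] l ^ 2) l =
      factorCount [D, U] l * (factorCount [D, U] l - 1) ^ 2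
        + (2 * factorCount [D, U] l - 1) * (factorCount [D, D, U] l + factorCount [D, U, U] l)
        + 2 * factorCount [D, D, U, U] l := by
  -- With `V` valleys, a flip leads to `V - 1 + a + b`, where `a`, `b` indicate a preceding `D` and
  -- a following `U`; in the square, `a` and `b` are idempotent and `a * b` detects `DDUU`.
  induction l using valleyFlips.induct with
  | case1 => simp
  | case2 t ih => simp [ih]
  | case3 => simp
  | case4 t ih =>
    rcases t with _ | ⟨_ | _, t⟩ <;> simp [add_sq, startsWith_sq, mul_assoc] at ih ⊢
    · rw [flipSum_mul_left, flipSum_valleys]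
      linear_combination ih
    · rw [flipSum_mul_left, flipSum_valleys]
      simp
      linear_combination ih +
        (startsWith [U] t + factorCount [D, U] t) * startsWith_sq [U] t
  | case5 t ih =>
    rcases t with _ | ⟨_ | _, t⟩ <;> simp [add_sq, startsWith_sq, mul_assoc] at ih ⊢
    · linear_combination ih
    · rw [flipSum_mul_left] at ih ⊢
      simp at ih ⊢
      linear_combination ih

/-- The number of factors `DDU` summed over the valley flips of a list. -/
theorem flipSum_DDU (l : List DyckStep) :
    flipSum (fun l => factorCount [D, D, U] l) l =
      (factorCount [D, U] l - 1) * factorCount [D, D, U] l + factorCount [D, D, D, U] l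
        + factorCount [D, U, D, U] l := by
  -- A factor `DDU` is destroyed only by flipping its own valley. A new one arises from `DDDU`
  -- (giving `DDUD`) or from the first valley of `DUDU` (giving `UDDU`).
  induction l using valleyFlips.induct with
  | case1 => simp
  | case2 t ih => simp [ih]
  | case3 => simp
  | case4 t ih =>
    rcases t with _ | ⟨_ | _, t⟩ <;> simp at ih ⊢ <;> linear_combination ih
  | case5 t ih =>
    rcases t with _ | ⟨_ | _, t⟩ <;> simp at ih ⊢ <;> linear_combination ih

/-- The number of factors `DUU` summed over the valley flips of a list. -/
theorem flipSum_DUU (l : List DyckStep) :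
    flipSum (fun l => factorCount [D, U, U] l) l =
      (factorCount [D, U] l - 1) * factorCount [D, U, U] l + factorCount [D, U, U, U] l
        + factorCount [D, U, D, U] l := by
  induction l using valleyFlips.induct with
  | case1 => simp
  | case2 t ih => simp [ih]
  | case3 => simp
  | case4 t ih =>
    rcases t with _ | ⟨_ | _, t⟩ <;> simp at ih ⊢ <;> linear_combination ih
  | case5 t ih =>
    rcases t with _ | ⟨_ | _, t⟩ <;> simp at ih ⊢ <;> linear_combination ih

/-- Only `V³`, `V²` and `V` times the number of factors `DDU` and `DUU` are nonlinear; the rest is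
additive in factor counts, hence easy to sum over trees. -/
theorem flipCount_three (l : List DyckStep) :
    flipCount 3 l = factorCount [D, U] l ^ 3 - 3 * factorCount [D, U] l ^ 2
      + 3 * (factorCount [D, U] l * (factorCount [D, D, U] l + factorCount [D, U, U] l))
      + (2 * factorCount [D, U] l - 3 * (factorCount [D, D, U] l + factorCount [D, U, U] l)
        + 2 * factorCount [D, D, U, U] l + factorCount [D, D, D, U] l
        + 2 * factorCount [D, U, D, U] l + factorCount [D, U, U, U] l) := by
  have h₁ : flipCount 1 = fun l => factorCount [D, U] l := funext flipSum_one
  have h₂ : flipCount 2 = fun l => factorCount [D, U] l ^ 2 + (-1) * factorCount [D, U] l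
      + factorCount [D, D, U] l + factorCount [D, U, U] l := by
    funext l
    rw [flipCount, h₁, flipSum_valleys]
    ring
  rw [flipCount, h₂]
  simp only [flipSum_add, flipSum_mul_left, flipSum_valleys, flipSum_valleys_sq, flipSum_DDU,
    flipSum_DUU]
  ring

/-! ### Factor counts across a junction `l D r` -/

section Append

variable (a b : DyckStep) (w l r : List DyckStep)

@[simp]
theorem endsWith_nil : endsWith (a :: w) [] = 0 := by simp [endsWith]

@[simp]
theorem endsWith_singleton : endsWith [a] [b] = if a = b then 1 else 0 := by
  simp [endsWith, List.suffix_cons_iff]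

@[simp]
theorem endsWith_pair_singleton (a' : DyckStep) : endsWith [a, a'] [b] = 0 := by
  simp [endsWith, List.suffix_cons_iff]

@[simp]
theorem endsWith_singleton_cons_cons (b' : DyckStep) :
    endsWith [a] (b :: b' :: l) = endsWith [a] (b' :: l) := by
  simp [endsWith, List.suffix_cons_iff]

@[simp]
theorem endsWith_pair_pair (a' b' : DyckStep) :
    endsWith [a, a'] [b, b'] = if a = b then if a' = b' then 1 else 0 else 0 := by
  by_cases h : a = b <;> simp [endsWith, List.suffix_cons_iff, h]

@[simp]
theorem endsWith_pair_cons_cons_cons (a' b' b'' : DyckStep) :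
    endsWith [a, a'] (b :: b' :: b'' :: l) = endsWith [a, a'] (b' :: b'' :: l) := by
  simp [endsWith, List.suffix_cons_iff]

/-- An occurrence of a factor lies in `l`, lies in `r`, or covers the middle `D`. Here and below,
the correction terms run over the letters `D` of the factor that can be this middle one. -/
theorem factorCount_DU_append :
    factorCount [D, U] (l ++ D :: r) = factorCount [D, U] l + startsWith [U] r
      + factorCount [D, U] r := by
  induction l with
  | nil => simp
  | cons a l ih =>
    rcases a with _ | _ <;> rcases l with _ | ⟨_ | _, l⟩ <;> simp at ih ⊢ <;> linear_combination ih

theorem factorCount_DDU_append :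
    factorCount [D, D, U] (l ++ D :: r) = factorCount [D, D, U] l
      + endsWith [D] l * startsWith [U] r + startsWith [D, U] r + factorCount [D, D, U] r := by
  induction l with
  | nil => simp
  | cons a l ih =>
    rcases a with _ | _ <;> rcases l with _ | ⟨_ | _, _ | ⟨_ | _, l⟩⟩ <;> simp at ih ⊢ <;>
      linear_combination ih

theorem factorCount_DUU_append :
    factorCount [D, U, U] (l ++ D :: r) = factorCount [D, U, U] l
      + startsWith [U, U] r + factorCount [D, U, U] r := by
  induction l with
  | nil => simp
  | cons a l ih =>
    rcases a with _ | _ <;> rcases l with _ | ⟨_ | _, _ | ⟨_ | _, l⟩⟩ <;> simp at ih ⊢ <;>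
      linear_combination ih

theorem factorCount_DDUU_append :
    factorCount [D, D, U, U] (l ++ D :: r) = factorCount [D, D, U, U] l
      + endsWith [D] l * startsWith [U, U] r + startsWith [D, U, U] r
      + factorCount [D, D, U, U] r := by
  induction l with
  | nil => simp
  | cons a l ih =>
    rcases a with _ | _ <;> rcases l with _ | ⟨_ | _, _ | ⟨_ | _, _ | ⟨_ | _, l⟩⟩⟩ <;>
      simp at ih ⊢ <;> linear_combination ih

theorem factorCount_DDDU_append :
    factorCount [D, D, D, U] (l ++ D :: r) = factorCount [D, D, D, U] l
      + endsWith [D, D] l * startsWith [U] r + endsWith [D] l * startsWith [D, U] r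
      + startsWith [D, D, U] r + factorCount [D, D, D, U] r := by
  induction l with
  | nil => simp
  | cons a l ih =>
    rcases a with _ | _ <;> rcases l with _ | ⟨_ | _, _ | ⟨_ | _, _ | ⟨_ | _, l⟩⟩⟩ <;>
      simp at ih ⊢ <;> linear_combination ih

theorem factorCount_DUDU_append :
    factorCount [D, U, D, U] (l ++ D :: r) = factorCount [D, U, D, U] l
      + endsWith [D, U] l * startsWith [U] r
      + startsWith [U, D, U] r + factorCount [D, U, D, U] r := by
  induction l with
  | nil => simp
  | cons a l ih =>
    rcases a with _ | _ <;> rcases l with _ | ⟨_ | _, _ | ⟨_ | _, _ | ⟨_ | _, l⟩⟩⟩ <;>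
      simp at ih ⊢ <;> linear_combination ih

theorem factorCount_DUUU_append :
    factorCount [D, U, U, U] (l ++ D :: r) = factorCount [D, U, U, U] l
      + startsWith [U, U, U] r + factorCount [D, U, U, U] r := by
  induction l with
  | nil => simp
  | cons a l ih =>
    rcases a with _ | _ <;> rcases l with _ | ⟨_ | _, _ | ⟨_ | _, _ | ⟨_ | _, l⟩⟩⟩ <;>
      simp at ih ⊢ <;> linear_combination ih

theorem endsWith_append_of_length_le (h : w.length ≤ r.length) :
    endsWith w (l ++ r) = endsWith w r := by
  have : w <:+ l ++ r ↔ w <:+ r :=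
    ⟨fun hw => List.suffix_of_suffix_length_le hw (List.suffix_append l r) h,
      fun hw => hw.trans (List.suffix_append l r)⟩
  simp [endsWith, this]

theorem endsWith_DD_append_singleton : endsWith [D, D] (l ++ [D]) = endsWith [D] l := by
  induction l with
  | nil => simp
  | cons a l ih => rcases a with _ | _ <;> rcases l with _ | ⟨_ | _, _ | ⟨_ | _, l⟩⟩ <;> simp_all

theorem endsWith_DU_append_singleton : endsWith [D, U] (l ++ [D]) = 0 := by
  induction l with
  | nil => simp
  | cons a l ih => rcases a with _ | _ <;> rcases l with _ | ⟨_ | _, _ | ⟨_ | _, l⟩⟩ <;> simp_all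

end Append

/-! ### Dyck words as binary trees -/

/-- The Dyck word of a binary tree, as a list of steps. -/
def treeWord (t : BinaryTree Unit) : List DyckStep := (DyckWord.ofTree t).toList

@[simp]
theorem treeWord_nil : treeWord nil = [] := rfl

@[simp]
theorem treeWord_node (a : Unit) (l r : BinaryTree Unit) :
    treeWord (node a l r) = U :: (treeWord l ++ D :: treeWord r) := by
  change (([U] ++ treeWord l) ++ [D]) ++ treeWord r = _
  simp

theorem DyckPath.sum_eq_sum_trees (n : ℕ) (f : List DyckStep → ℚ) :
    ∑ γ : DyckPath n, f γ.word.toList = ∑ t ∈ treesOfNumNodesEq n, f (treeWord t) := by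
  refine Finset.sum_bij' (fun γ _ => γ.word.toTree)
    (fun t ht => ⟨DyckWord.ofTree t, ?_⟩) ?_ ?_ ?_ ?_ ?_
  · rw [← DyckWord.numNodes_toTree, DyckWord.toTree_ofTree]
    exact mem_treesOfNumNodesEq.1 ht
  · intro γ _
    rw [mem_treesOfNumNodesEq, DyckWord.numNodes_toTree, γ.semilength_word]
  · simp
  · intro γ _
    exact DyckPath.ext (DyckWord.ofTree_toTree _)
  · intro t _
    exact DyckWord.toTree_ofTree _
  · intro γ _
    rw [treeWord, DyckWord.ofTree_toTree]

/-- Dyck words never begin with `D`, which kills many junction terms. -/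
theorem startsWith_treeWord_of_D (w : List DyckStep) (t : BinaryTree Unit) :
    startsWith (D :: w) (treeWord t) = 0 := by
  cases t <;> simp

theorem endsWith_treeWord_node (w : List DyckStep) (hw : w.length ≤ 2) (l r₁ r₂ : BinaryTree Unit) :
    endsWith w (treeWord (l △ (r₁ △ r₂))) = endsWith w (treeWord (r₁ △ r₂)) := by
  rw [treeWord_node, ← List.cons_append, List.append_cons, endsWith_append_of_length_le]
  simp
  omega

/-- Both sides indicate that the word is nonempty. -/
theorem endsWith_D_treeWord (t : BinaryTree Unit) :
    endsWith [D] (treeWord t) = startsWith [U] (treeWord t) := by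
  induction t using BinaryTree.unitRecOn with
  | base => simp
  | ind l r _ ih =>
    rcases r with _ | ⟨_, r₁, r₂⟩
    · rw [treeWord_node, ← List.cons_append, endsWith_append_of_length_le _ _ _ (by simp)]
      simp
    · rw [endsWith_treeWord_node _ (by simp), ih]
      simp

/-- If `r` is nonempty it decides the ending; otherwise the word is `U l D`, and the question is
whether `l` is nonempty. -/
theorem endsWith_DD_treeWord (l r : BinaryTree Unit) :
    endsWith [D, D] (treeWord (l △ r)) =
      endsWith [D, D] (treeWord r) + (1 - startsWith [U] (treeWord r)) *
        startsWith [U] (treeWord l) := by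
  rcases r with _ | ⟨_, r₁, r₂⟩
  · rw [treeWord_node, ← List.cons_append, treeWord_nil, endsWith_DD_append_singleton,
      ← endsWith_D_treeWord]
    rcases treeWord l with _ | ⟨a, t⟩ <;> simp
  · rw [endsWith_treeWord_node _ (by simp)]
    simp

theorem endsWith_DU_treeWord (t : BinaryTree Unit) :
    endsWith [D, U] (treeWord t) = 0 := by
  induction t using BinaryTree.unitRecOn with
  | base => simp
  | ind l r _ ih =>
    rcases r with _ | ⟨_, r₁, r₂⟩
    · rw [treeWord_node, ← List.cons_append, treeWord_nil, endsWith_DU_append_singleton]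
    · rw [endsWith_treeWord_node _ (by simp), ih]

/-! ### Generating series over trees -/

/-- The generating series of the binary trees by number of nodes, with weights `f`. -/
noncomputable def treeSeries (f : BinaryTree Unit → ℚ) : PowerSeries ℚ :=
  mk fun n => ∑ t ∈ treesOfNumNodesEq n, f t

/-- The generating series of the pairs of binary trees by number of nodes, with weights `F`. -/
noncomputable def treePairSeries (F : BinaryTree Unit → BinaryTree Unit → ℚ) : PowerSeries ℚ :=
  mk fun n => ∑ ij ∈ Finset.HasAntidiagonal.antidiagonal n,
    ∑ l ∈ treesOfNumNodesEq ij.1, ∑ r ∈ treesOfNumNodesEq ij.2, F l r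

theorem sum_treesOfNumNodesEq_succ (n : ℕ) (f : BinaryTree Unit → ℚ) :
    ∑ t ∈ treesOfNumNodesEq (n + 1), f t = ∑ ij ∈ Finset.HasAntidiagonal.antidiagonal n,
      ∑ l ∈ treesOfNumNodesEq ij.1, ∑ r ∈ treesOfNumNodesEq ij.2, f (l △ r) := by
  rw [treesOfNumNodesEq_succ, Finset.sum_biUnion]
  · refine Finset.sum_congr rfl fun ij _ => ?_
    rw [Finset.sum_map, Finset.sum_product]
    rfl
  · simp_rw [Set.PairwiseDisjoint, Set.Pairwise, Function.onFun, Finset.disjoint_left]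
    rintro ⟨i, j⟩ _ ⟨i', j'⟩ _ hne t h h'
    simp only [Finset.mem_map, Finset.mem_product, mem_treesOfNumNodesEq, Prod.exists] at h h'
    obtain ⟨a, b, ⟨rfl, rfl⟩, rfl⟩ := h
    obtain ⟨c, d, ⟨rfl, rfl⟩, he⟩ := h'
    simp at he
    exact hne (by rw [he.1, he.2])

theorem treeSeries_eq (f : BinaryTree Unit → ℚ) :
    treeSeries f = C (f nil) + X * treePairSeries fun l r => f (l △ r) := by
  ext n
  rcases n with _ | n
  · simp [treeSeries]
  · simp [treeSeries, treePairSeries, coeff_succ_X_mul, sum_treesOfNumNodesEq_succ]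

section Linear

variable (c : ℚ) (f g : BinaryTree Unit → ℚ)
  (F G : BinaryTree Unit → BinaryTree Unit → ℚ)

theorem treeSeries_add : treeSeries (fun t => f t + g t) = treeSeries f + treeSeries g := by
  ext n
  simp [treeSeries, Finset.sum_add_distrib]

theorem treeSeries_const_mul : treeSeries (fun t => c * f t) = C c * treeSeries f := by
  ext n
  simp [treeSeries, Finset.mul_sum]

theorem treePairSeries_add :
    treePairSeries (fun l r => F l r + G l r) = treePairSeries F + treePairSeries G := by
  ext n
  simp [treePairSeries, Finset.sum_add_distrib]

theorem treePairSeries_mul :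
    treePairSeries (fun l r => f l * g r) = treeSeries f * treeSeries g := by
  ext n
  simp [treePairSeries, treeSeries, coeff_mul, Finset.sum_mul_sum]

theorem treePairSeries_const_mul :
    treePairSeries (fun l r => c * (f l * g r)) = C c * (treeSeries f * treeSeries g) := by
  rw [← treePairSeries_mul]
  ext n
  simp [treePairSeries, Finset.mul_sum]

end Linear

/-! ### Recursions for the tree statistics -/

/-- `1` if the tree is a node (its word starts with `U`), and `0` otherwise. -/
def startsU (t : BinaryTree Unit) : ℚ := startsWith [U] (treeWord t)

/-- `1` if the word of the tree starts with `UU`, and `0` otherwise. -/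
def startsUU (t : BinaryTree Unit) : ℚ := startsWith [U, U] (treeWord t)

/-- `1` if the word of the tree starts with `UUU`, and `0` otherwise. -/
def startsUUU (t : BinaryTree Unit) : ℚ := startsWith [U, U, U] (treeWord t)

/-- `1` if the word of the tree starts with `UDU`, and `0` otherwise. -/
def startsUDU (t : BinaryTree Unit) : ℚ := startsWith [U, D, U] (treeWord t)

/-- `1` if the word of the tree ends with `DD`, and `0` otherwise. -/
def endsDD (t : BinaryTree Unit) : ℚ := endsWith [D, D] (treeWord t)

/-- The number of valleys of the word of a tree. -/
def valleys (t : BinaryTree Unit) : ℚ := factorCount [D, U] (treeWord t)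

/-- The number of factors `DDU` and `DUU` of the word of a tree. -/
def longValleys (t : BinaryTree Unit) : ℚ :=
  factorCount [D, D, U] (treeWord t) + factorCount [D, U, U] (treeWord t)

/-- The part of `flipCount 3` which is linear in the factor counts. -/
def linearFlips (t : BinaryTree Unit) : ℚ :=
  2 * valleys t - 3 * longValleys t + 2 * factorCount [D, D, U, U] (treeWord t)
    + factorCount [D, D, D, U] (treeWord t) + 2 * factorCount [D, U, D, U] (treeWord t)
    + factorCount [D, U, U, U] (treeWord t)

@[simp] theorem startsU_nil : startsU nil = 0 := by simp [startsU]
@[simp] theorem startsUU_nil : startsUU nil = 0 := by simp [startsUU]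
@[simp] theorem startsUUU_nil : startsUUU nil = 0 := by simp [startsUUU]
@[simp] theorem startsUDU_nil : startsUDU nil = 0 := by simp [startsUDU]
@[simp] theorem endsDD_nil : endsDD nil = 0 := by simp [endsDD]
@[simp] theorem valleys_nil : valleys nil = 0 := by simp [valleys]
@[simp] theorem longValleys_nil : longValleys nil = 0 := by simp [longValleys]
@[simp] theorem linearFlips_nil : linearFlips nil = 0 := by simp [linearFlips]

section Node

variable (l r t : BinaryTree Unit)

theorem startsU_node : startsU (l △ r) = 1 := by simp [startsU]

theorem startsUU_node : startsUU (l △ r) = startsU l := by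
  cases l <;> simp [startsU, startsUU]

theorem startsUUU_node : startsUUU (l △ r) = startsUU l := by
  rcases l with _ | ⟨_, l, l'⟩
  · simp [startsUUU, startsUU]
  · cases l <;> simp [startsUUU, startsUU]

theorem startsUDU_node : startsUDU (l △ r) = startsU r - startsU l * startsU r := by
  cases l <;> simp [startsUDU, startsU]

theorem endsDD_node : endsDD (l △ r) = endsDD r + (startsU l - startsU l * startsU r) := by
  rw [endsDD, endsWith_DD_treeWord]
  simp only [endsDD, startsU]
  ring

theorem valleys_node : valleys (l △ r) = valleys l + valleys r + startsU r := by
  simp [valleys, startsU, factorCount_DU_append]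
  ring

theorem longValleys_node :
    longValleys (l △ r) = longValleys l + longValleys r + startsU l * startsU r + startsUU r := by
  simp [longValleys, startsU, startsUU, factorCount_DDU_append, factorCount_DUU_append,
    endsWith_D_treeWord, startsWith_treeWord_of_D]
  ring

theorem linearFlips_node :
    linearFlips (l △ r) = linearFlips l + linearFlips r + 2 * startsU r
      - 3 * (startsU l * startsU r + startsUU r) + 2 * (startsU l * startsUU r)
      + endsDD l * startsU r + 2 * startsUDU r + startsUUU r := by
  rw [linearFlips, valleys_node, longValleys_node]
  simp [linearFlips, startsU, startsUU, startsUUU, startsUDU, endsDD, factorCount_DDUU_append,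
    factorCount_DDDU_append, factorCount_DUDU_append, factorCount_DUUU_append,
    endsWith_D_treeWord, endsWith_DU_treeWord, startsWith_treeWord_of_D]
  ring

/-- `startsU` is 1 except on the empty tree, where the statistics vanish; this and the next three
lemmas absorb it when products are expanded. -/
theorem startsU_mul_self : startsU t * startsU t = startsU t := by
  cases t <;> simp [startsU]

theorem valleys_mul_startsU : valleys t * startsU t = valleys t := by
  cases t <;> simp [startsU]

theorem longValleys_mul_startsU : longValleys t * startsU t = longValleys t := by
  cases t <;> simp [startsU]

theorem startsUU_mul_startsU : startsUU t * startsU t = startsUU t := by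
  cases t <;> simp [startsU]

theorem flipCount_three_treeWord :
    flipCount 3 (treeWord t) = valleys t ^ 3 + (-3) * valleys t ^ 2
      + 3 * (valleys t * longValleys t) + linearFlips t := by
  rw [flipCount_three]
  simp only [valleys, longValleys, linearFlips]
  ring

end Node

/-! ### Functional equations for the moments -/

theorem treeSeries_of_node {f : BinaryTree Unit → ℚ} {F : BinaryTree Unit → BinaryTree Unit → ℚ}
    (h₀ : f nil = 0) (h : ∀ l r, f (l △ r) = F l r) :
    treeSeries f = X * treePairSeries F := by
  rw [treeSeries_eq, h₀, map_zero, zero_add]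
  congr 2
  funext l r
  exact h l r

theorem treeSeries_one : treeSeries (fun _ => 1) =
    1 + X * (treeSeries (fun _ => 1) * treeSeries (fun _ => 1)) := by
  conv_lhs => rw [treeSeries_eq]
  rw [← treePairSeries_mul]
  simp

theorem treeSeries_startsU : treeSeries startsU = treeSeries (fun _ => 1) - 1 := by
  rw [eq_sub_iff_add_eq]
  conv_rhs => rw [treeSeries_eq]
  rw [treeSeries_of_node startsU_nil startsU_node]
  simp [add_comm]

theorem treeSeries_startsUU :
    treeSeries startsUU = X * (treeSeries startsU * treeSeries (fun _ => 1)) := by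
  rw [treeSeries_of_node (F := fun l r => startsU l * 1) (by simp) (by simp [startsUU_node]),
    treePairSeries_mul]

theorem treeSeries_startsUUU :
    treeSeries startsUUU = X * (treeSeries startsUU * treeSeries (fun _ => 1)) := by
  rw [treeSeries_of_node (F := fun l r => startsUU l * 1) (by simp) (by simp [startsUUU_node]),
    treePairSeries_mul]

theorem treeSeries_startsUDU :
    treeSeries startsUDU = X * (treeSeries (fun _ => 1) * treeSeries startsU
      - treeSeries startsU * treeSeries startsU) := by
  rw [treeSeries_of_node (F := fun l r => 1 * startsU r + (-1) * (startsU l * startsU r))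
    (by simp) (fun l r => by rw [startsUDU_node]; ring)]
  simp only [treePairSeries_add, treePairSeries_const_mul, treePairSeries_mul, map_neg, map_one]
  ring

theorem treeSeries_endsDD :
    treeSeries endsDD = X * (treeSeries (fun _ => 1) * treeSeries endsDD
      + treeSeries startsU * treeSeries (fun _ => 1)
      - treeSeries startsU * treeSeries startsU) := by
  conv_lhs => rw [treeSeries_of_node
    (F := fun l r => 1 * endsDD r + startsU l * 1 + (-1) * (startsU l * startsU r))
    (by simp) (fun l r => by rw [endsDD_node]; ring)]
  simp only [treePairSeries_add, treePairSeries_const_mul, treePairSeries_mul, map_neg, map_one]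
  ring

theorem treeSeries_valleys :
    treeSeries valleys = X * (2 * (treeSeries (fun _ => 1) * treeSeries valleys)
      + treeSeries (fun _ => 1) * treeSeries startsU) := by
  conv_lhs => rw [treeSeries_of_node
    (F := fun l r => valleys l * 1 + 1 * valleys r + 1 * startsU r)
    (by simp) (fun l r => by rw [valleys_node]; ring)]
  simp only [treePairSeries_add, treePairSeries_mul]
  ring

theorem treeSeries_longValleys :
    treeSeries longValleys = X * (2 * (treeSeries (fun _ => 1) * treeSeries longValleys)
      + treeSeries startsU * treeSeries startsU
      + treeSeries (fun _ => 1) * treeSeries startsUU) := by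
  conv_lhs => rw [treeSeries_of_node
    (F := fun l r => longValleys l * 1 + 1 * longValleys r + startsU l * startsU r
      + 1 * startsUU r)
    (by simp) (fun l r => by rw [longValleys_node]; ring)]
  simp only [treePairSeries_add, treePairSeries_mul]
  ring

theorem treeSeries_linearFlips :
    treeSeries linearFlips = X * (2 * (treeSeries (fun _ => 1) * treeSeries linearFlips)
      + 2 * (treeSeries (fun _ => 1) * treeSeries startsU)
      - 3 * (treeSeries startsU * treeSeries startsU
        + treeSeries (fun _ => 1) * treeSeries startsUU)
      + 2 * (treeSeries startsU * treeSeries startsUU) + treeSeries endsDD * treeSeries startsU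
      + 2 * (treeSeries (fun _ => 1) * treeSeries startsUDU)
      + treeSeries (fun _ => 1) * treeSeries startsUUU) := by
  conv_lhs => rw [treeSeries_of_node
    (F := fun l r => linearFlips l * 1 + 1 * linearFlips r + 2 * (1 * startsU r)
      + (-3) * (startsU l * startsU r) + (-3) * (1 * startsUU r) + 2 * (startsU l * startsUU r)
      + endsDD l * startsU r + 2 * (1 * startsUDU r) + 1 * startsUUU r)
    (by simp) (fun l r => by rw [linearFlips_node]; ring)]
  simp only [treePairSeries_add, treePairSeries_const_mul, treePairSeries_mul, map_neg, map_ofNat]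
  ring

/-- This mixed moment enters the equation for `valleys * longValleys`, through the indicator
`startsUU r` in `longValleys_node`. -/
theorem treeSeries_valleys_mul_startsUU :
    treeSeries (fun t => valleys t * startsUU t) =
      X * (treeSeries valleys * treeSeries (fun _ => 1) + treeSeries startsU * treeSeries valleys
        + treeSeries startsU * treeSeries startsU) := by
  rw [treeSeries_of_node
    (F := fun l r => valleys l * 1 + startsU l * valleys r + startsU l * startsU r)
    (by simp) (fun l r => by
      rw [valleys_node, startsUU_node]
      linear_combination valleys_mul_startsU l)]
  simp only [treePairSeries_add, treePairSeries_mul]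

theorem treeSeries_valleys_sq :
    treeSeries (fun t => valleys t ^ 2) =
      X * (2 * (treeSeries (fun _ => 1) * treeSeries fun t => valleys t ^ 2)
        + treeSeries (fun _ => 1) * treeSeries startsU
        + 2 * (treeSeries valleys * treeSeries valleys)
        + 2 * (treeSeries valleys * treeSeries startsU)
        + 2 * (treeSeries (fun _ => 1) * treeSeries valleys)) := by
  conv_lhs => rw [treeSeries_of_node
    (F := fun l r => valleys l ^ 2 * 1 + 1 * valleys r ^ 2 + 1 * startsU r
      + 2 * (valleys l * valleys r) + 2 * (valleys l * startsU r) + 2 * (1 * valleys r))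
    (by simp) (fun l r => by
      rw [valleys_node]
      linear_combination 2 * valleys_mul_startsU r + startsU_mul_self r)]
  simp only [treePairSeries_add, treePairSeries_const_mul, treePairSeries_mul, map_ofNat]
  ring

theorem treeSeries_valleys_cube :
    treeSeries (fun t => valleys t ^ 3) =
      X * (2 * (treeSeries (fun _ => 1) * treeSeries fun t => valleys t ^ 3)
        + treeSeries (fun _ => 1) * treeSeries startsU
        + 6 * ((treeSeries fun t => valleys t ^ 2) * treeSeries valleys)
        + 3 * ((treeSeries fun t => valleys t ^ 2) * treeSeries startsU)
        + 3 * (treeSeries valleys * treeSeries startsU)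
        + 3 * (treeSeries (fun _ => 1) * treeSeries fun t => valleys t ^ 2)
        + 3 * (treeSeries (fun _ => 1) * treeSeries valleys)
        + 6 * (treeSeries valleys * treeSeries valleys)) := by
  conv_lhs => rw [treeSeries_of_node
    (F := fun l r => valleys l ^ 3 * 1 + 1 * valleys r ^ 3 + 1 * startsU r
      + 3 * (valleys l ^ 2 * valleys r) + 3 * (valleys l ^ 2 * startsU r)
      + 3 * (valleys l * valleys r ^ 2) + 3 * (valleys l * startsU r)
      + 3 * (1 * valleys r ^ 2) + 3 * (1 * valleys r) + 6 * (valleys l * valleys r))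
    (by simp) (fun l r => by
      rw [valleys_node]
      linear_combination (6 * valleys l + 3 * valleys r + 3 * startsU r + 3)
        * valleys_mul_startsU r + (3 * valleys l + startsU r + 1) * startsU_mul_self r)]
  simp only [treePairSeries_add, treePairSeries_const_mul, treePairSeries_mul, map_ofNat]
  ring

theorem treeSeries_valleys_mul_longValleys :
    treeSeries (fun t => valleys t * longValleys t) =
      X * (2 * (treeSeries (fun _ => 1) * treeSeries fun t => valleys t * longValleys t)
        + 2 * (treeSeries valleys * treeSeries longValleys)
        + 2 * (treeSeries valleys * treeSeries startsU)
        + treeSeries valleys * treeSeries startsUU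
        + treeSeries (fun _ => 1) * (treeSeries fun t => valleys t * startsUU t)
        + treeSeries longValleys * treeSeries startsU
        + treeSeries (fun _ => 1) * treeSeries longValleys
        + treeSeries startsU * treeSeries startsU
        + treeSeries (fun _ => 1) * treeSeries startsUU) := by
  conv_lhs => rw [treeSeries_of_node
    (F := fun l r => (valleys l * longValleys l) * 1 + 1 * (valleys r * longValleys r)
      + valleys l * longValleys r + longValleys l * valleys r
      + valleys l * startsU r + startsU l * valleys r + valleys l * startsUU r
      + 1 * (valleys r * startsUU r) + longValleys l * startsU r + 1 * longValleys r
      + startsU l * startsU r + 1 * startsUU r)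
    (by simp) (fun l r => by
      rw [valleys_node, longValleys_node]
      linear_combination startsU r * valleys_mul_startsU l + startsU l * valleys_mul_startsU r
        + longValleys_mul_startsU r + startsU l * startsU_mul_self r + startsUU_mul_startsU r)]
  simp only [treePairSeries_add, treePairSeries_mul]
  ring

theorem treeSeries_flipCount_three :
    treeSeries (fun t => flipCount 3 (treeWord t)) =
      treeSeries (fun t => valleys t ^ 3) - 3 * treeSeries (fun t => valleys t ^ 2)
        + 3 * treeSeries (fun t => valleys t * longValleys t) + treeSeries linearFlips := by
  simp only [flipCount_three_treeWord, treeSeries_add, treeSeries_const_mul, map_neg, map_ofNat]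
  ring

theorem SC_eq_treeSeries (h : ℕ) : SC h = treeSeries fun t => flipCount h (treeWord t) := by
  ext n
  rw [SC, coeff_mk, sc_eq_sum_flipCount, DyckPath.sum_eq_sum_trees, treeSeries, coeff_mk]

/-! ### Solving the system and the closed form -/

/-- Each moment equation is linear in its unknown with coefficient `1 - 2xc = s`, so division by `s`
solves it; `s` then parametrizes everything rationally. -/
theorem solve_valley_system {K : Type*} [Field K] [CharZero K]
    {x c s e uu uuu udu dd v m vu v2 v3 vm L : K}
    (hs : s = 1 - 2 * x * c) (hs₀ : s ≠ 0) (hs₁ : 1 + s ≠ 0) (hc : c = 1 + x * (c * c))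
    (he : e = c - 1) (huu : uu = x * (e * c)) (huuu : uuu = x * (uu * c))
    (hudu : udu = x * (c * e - e * e)) (hdd : dd = x * (c * dd + e * c - e * e))
    (hv : v = x * (2 * (c * v) + c * e))
    (hm : m = x * (2 * (c * m) + e * e + c * uu))
    (hL : L = x * (2 * (c * L) + 2 * (c * e) - 3 * (e * e + c * uu) + 2 * (e * uu) + dd * e
      + 2 * (c * udu) + c * uuu))
    (hvu : vu = x * (v * c + e * v + e * e))
    (hv2 : v2 = x * (2 * (c * v2) + c * e + 2 * (v * v) + 2 * (v * e) + 2 * (c * v)))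
    (hv3 : v3 = x * (2 * (c * v3) + c * e + 6 * (v2 * v) + 3 * (v2 * e) + 3 * (v * e)
      + 3 * (c * v2) + 3 * (c * v) + 6 * (v * v)))
    (hvm : vm = x * (2 * (c * vm) + 2 * (v * m) + 2 * (v * e) + v * uu + c * vu + m * e + c * m
      + e * e + c * uu)) :
    x * (1 - 4 * x) ^ 3 * (v3 - 3 * v2 + 3 * vm + L) =
      (1 - 13 * x + 59 * x ^ 2 - 100 * x ^ 3 + 16 * x ^ 4 + 64 * x ^ 5)
        - (1 - 11 * x + 39 * x ^ 2 - 40 * x ^ 3 - 22 * x ^ 4) * s := by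
  have hx : x = (1 - s ^ 2) / 4 := by
    rw [hs]; linear_combination (-x) * hc
  have hc' : c = 2 / (1 + s) := by
    rw [eq_div_iff hs₁, hs]; linear_combination 2 * hc
  have he' : e = (1 - s) / (1 + s) := by
    rw [he, hc']; field_simp; ring
  have huu' : uu = (1 - s) ^ 2 / (2 * (1 + s)) := by
    rw [huu, hx, he', hc']; field_simp; ring
  have huuu' : uuu = (1 - s) ^ 3 / (4 * (1 + s)) := by
    rw [huuu, hx, huu', hc']; field_simp; ring
  have hudu' : udu = (1 - s) ^ 2 / 4 := by
    rw [hudu, hx, he', hc']; field_simp; ring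
  have hdd' : dd = (1 - s) ^ 2 / (2 * (1 + s)) := by
    -- Only one of the two subtrees contributes `dd`, so its coefficient is `1 - xc = (1 + s) / 2`
    -- instead of `s`.
    have h : dd * (1 + s) = 2 * x * e * (c - e) := by
      rw [hs]; linear_combination 2 * hdd
    have h' : dd = 2 * x * e * (c - e) / (1 + s) := by rw [eq_div_iff hs₁, h]
    rw [h', hx, he', hc']; field_simp; ring
  have hv' : v = (1 - s) ^ 2 / (2 * (1 + s) * s) := by
    have h : v = x * c * e / s := by
      rw [eq_div_iff hs₀, hs]; linear_combination hv
    rw [h, hx, he', hc']; field_simp; ring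
  have hm' : m = x * (e * e + c * uu) / s := by
    rw [eq_div_iff hs₀, hs]; linear_combination hm
  have hL' : L = x * (2 * (c * e) - 3 * (e * e + c * uu) + 2 * (e * uu) + dd * e
      + 2 * (c * udu) + c * uuu) / s := by
    rw [eq_div_iff hs₀, hs]; linear_combination hL
  have hv2' : v2 = x * (c * e + 2 * (v * v) + 2 * (v * e) + 2 * (c * v)) / s := by
    rw [eq_div_iff hs₀, hs]; linear_combination hv2
  have hv3' : v3 = x * (c * e + 6 * (v2 * v) + 3 * (v2 * e) + 3 * (v * e)
      + 3 * (c * v2) + 3 * (c * v) + 6 * (v * v)) / s := by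
    rw [eq_div_iff hs₀, hs]; linear_combination hv3
  have hvm' : vm = x * (2 * (v * m) + 2 * (v * e) + v * uu + c * vu + m * e + c * m
      + e * e + c * uu) / s := by
    rw [eq_div_iff hs₀, hs]; linear_combination hvm
  -- Substituting in reverse order of dependence leaves an identity between rational functions of
  -- `s` alone.
  rw [hv3', hvm', hv2', hL', hvu, hm', hv', hdd', hudu', huuu', huu', he', hc', hx]
  clear * - hs₀ hs₁
  field_simp
  ring

theorem coeff_treeSeries_one (n : ℕ) : coeff n (treeSeries fun _ => 1) = catalan n := by
  simp [treeSeries, treesOfNumNodesEq_card_eq_catalan]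

/-- By the Catalan equation both sides square to `1 - 4X`; the opposite sign is excluded since the
sum has constant term 2. -/
theorem sqrtOneSubFourX_eq :
    sqrtOneSubFourX = 1 - 2 * X * treeSeries (fun _ => 1) := by
  have h : (sqrtOneSubFourX - (1 - 2 * X * treeSeries fun _ => 1)) *
      (sqrtOneSubFourX + (1 - 2 * X * treeSeries fun _ => 1)) = 0 := by
    linear_combination sqrtOneSubFourX_sq + 4 * X * treeSeries_one
  rcases mul_eq_zero.1 h with h | h
  · exact sub_eq_zero.1 h
  · have := congrArg constantCoeff h
    simp [constantCoeff_sqrtOneSubFourX] at this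

theorem polyP_eq :
    polyP = (1 - 4 * Polynomial.X) ^ 3 * (1 - Polynomial.X - Polynomial.X ^ 2) := by
  rw [polyP]
  ring

theorem coe_polyP :
    (polyP : PowerSeries ℚ) =
      1 - 13 * X + 59 * X ^ 2 - 100 * X ^ 3 + 16 * X ^ 4 + 64 * X ^ 5 := by
  change Polynomial.coeToPowerSeries.ringHom polyP = _
  rw [polyP]
  simp only [map_add, map_sub, map_mul, map_pow, map_one, map_ofNat,
    Polynomial.coeToPowerSeries.ringHom_apply, Polynomial.coe_X]

theorem coe_polyQ :
    (polyQ : PowerSeries ℚ) = 1 - 11 * X + 39 * X ^ 2 - 40 * X ^ 3 - 22 * X ^ 4 := by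
  change Polynomial.coeToPowerSeries.ringHom polyQ = _
  rw [polyQ]
  simp only [map_add, map_sub, map_mul, map_pow, map_one, map_ofNat,
    Polynomial.coeToPowerSeries.ringHom_apply, Polynomial.coe_X]

/-- Laurent series form a field, where the system can be solved; `s` and `1 + s` are nonzero because
their constant terms are. -/
theorem SC_three_laurent :
    ((X : PowerSeries ℚ) : LaurentSeries ℚ) * (1 - 4 * ((X : PowerSeries ℚ) : LaurentSeries ℚ)) ^ 3
      * ((SC 3 : PowerSeries ℚ) : LaurentSeries ℚ) =
      ((polyP : PowerSeries ℚ) : LaurentSeries ℚ)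
        - ((polyQ : PowerSeries ℚ) : LaurentSeries ℚ) *
          ((sqrtOneSubFourX : PowerSeries ℚ) : LaurentSeries ℚ) := by
  have lift {f g : PowerSeries ℚ} (h : f = g) :
      HahnSeries.ofPowerSeries ℤ ℚ f = HahnSeries.ofPowerSeries ℤ ℚ g := congrArg _ h
  have ne {f : PowerSeries ℚ} (h : constantCoeff f ≠ 0) :
      HahnSeries.ofPowerSeries ℤ ℚ f ≠ 0 := by
    rw [Ne, map_eq_zero_iff _ HahnSeries.ofPowerSeries_injective]
    rintro rfl
    simp at h
  have h₁ := ne (f := sqrtOneSubFourX) (by simp [constantCoeff_sqrtOneSubFourX])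
  have h₂ := ne (f := 1 + sqrtOneSubFourX) (by simp [constantCoeff_sqrtOneSubFourX])
  rw [map_add, map_one] at h₂
  have : CharZero (LaurentSeries ℚ) :=
    charZero_of_injective_ringHom (f := (HahnSeries.ofPowerSeries ℤ ℚ).comp (C (R := ℚ)))
      (HahnSeries.ofPowerSeries_injective.comp C_injective)
  have key := solve_valley_system
    (by simpa only [map_sub, map_mul, map_one, map_ofNat] using lift sqrtOneSubFourX_eq) h₁ h₂
    (by simpa only [map_add, map_mul, map_one] using lift treeSeries_one)
    (by simpa only [map_sub, map_one] using lift treeSeries_startsU)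
    (by simpa only [map_mul] using lift treeSeries_startsUU)
    (by simpa only [map_mul] using lift treeSeries_startsUUU)
    (by simpa only [map_mul, map_sub] using lift treeSeries_startsUDU)
    (by simpa only [map_mul, map_sub, map_add] using lift treeSeries_endsDD)
    (by simpa only [map_mul, map_add, map_ofNat] using lift treeSeries_valleys)
    (by simpa only [map_mul, map_add, map_ofNat] using lift treeSeries_longValleys)
    (by simpa only [map_mul, map_sub, map_add, map_ofNat] using lift treeSeries_linearFlips)
    (by simpa only [map_mul, map_add] using lift treeSeries_valleys_mul_startsUU)
    (by simpa only [map_mul, map_add, map_ofNat] using lift treeSeries_valleys_sq)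
    (by simpa only [map_mul, map_add, map_ofNat] using lift treeSeries_valleys_cube)
    (by simpa only [map_mul, map_add, map_ofNat] using lift treeSeries_valleys_mul_longValleys)
  have hSC := lift ((SC_eq_treeSeries 3).trans treeSeries_flipCount_three)
  simp only [map_mul, map_add, map_sub, map_ofNat] at hSC
  rw [hSC, key, coe_polyP, coe_polyQ]
  simp only [map_mul, map_add, map_sub, map_pow, map_one, map_ofNat]

theorem X_mul_SC_three :
    X * (1 - 4 * X) ^ 3 * SC 3 =
      (polyP : PowerSeries ℚ) - (polyQ : PowerSeries ℚ) * sqrtOneSubFourX := by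
  apply HahnSeries.ofPowerSeries_injective (Γ := ℤ) (R := ℚ)
  simpa only [map_mul, map_sub, map_pow, map_one, map_ofNat] using SC_three_laurent

/-! ### Extracting the coefficients -/

/-- The generating series of the central binomial coefficients, i.e. `1 / √(1 - 4x)`. -/
noncomputable def centralBinomSeries : PowerSeries ℚ := mk fun n => (n.centralBinom : ℚ)

/-- The identity `(n + 1) * catalan n = n.centralBinom` says that `X * c` has derivative
`centralBinomSeries`. -/
theorem derivative_sqrtOneSubFourX :
    derivative ℚ sqrtOneSubFourX = -2 * centralBinomSeries := by
  have h : derivative ℚ (X * treeSeries fun _ => 1) = centralBinomSeries := by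
    ext n
    rw [coeff_derivative, coeff_succ_X_mul, coeff_treeSeries_one, centralBinomSeries, coeff_mk,
      ← succ_mul_catalan_eq_centralBinom]
    push_cast
    ring
  have h2 : sqrtOneSubFourX = 1 - C 2 * (X * treeSeries fun _ => 1) := by
    rw [sqrtOneSubFourX_eq, map_ofNat]
    ring
  rw [h2, map_sub, Derivation.map_one_eq_zero, Derivation.leibniz, h,
    derivative_C, map_ofNat]
  simp

/-- Differentiating `s² = 1 - 4X` with `s' = -2b` gives `-4 s b = -4`. -/
theorem sqrtOneSubFourX_mul_centralBinomSeries :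
    sqrtOneSubFourX * centralBinomSeries = 1 := by
  have h4 : derivative ℚ (1 - 4 * X) = -4 := by
    rw [← map_ofNat (C (R := ℚ)) 4, map_sub, Derivation.map_one_eq_zero, Derivation.leibniz,
      derivative_C, derivative_X]
    simp
  have h := congrArg (derivative ℚ) sqrtOneSubFourX_sq
  rw [derivative_pow, derivative_sqrtOneSubFourX, h4] at h
  have h0 : (-4 : PowerSeries ℚ) ≠ 0 := by
    rw [← map_ofNat (C (R := ℚ)) 4, ← map_neg, Ne, map_eq_zero_iff _ C_injective]
    norm_num
  apply mul_left_cancel₀ h0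
  simp at h
  linear_combination -h

theorem derivative_centralBinomSeries :
    derivative ℚ centralBinomSeries = 2 * centralBinomSeries ^ 3 := by
  have h := congrArg (derivative ℚ) sqrtOneSubFourX_mul_centralBinomSeries
  rw [Derivation.leibniz, derivative_sqrtOneSubFourX, Derivation.map_one_eq_zero,
    smul_eq_mul, smul_eq_mul] at h
  linear_combination centralBinomSeries * h -
    derivative ℚ centralBinomSeries * sqrtOneSubFourX_mul_centralBinomSeries

theorem derivative_derivative_centralBinomSeries :
    derivative ℚ (derivative ℚ centralBinomSeries) = 12 * centralBinomSeries ^ 5 := by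
  rw [derivative_centralBinomSeries, ← map_ofNat (C (R := ℚ)) 2, Derivation.leibniz,
    derivative_C, derivative_pow, derivative_centralBinomSeries, map_ofNat, smul_zero, add_zero,
    smul_eq_mul]
  push_cast
  ring

/-- Since `(1 - 4X)³ = s⁶`, multiplying the closed form by `b⁶` turns `P` into `1 - X - X²` and `Q
s` into `Q b⁵`; the factor 12 comes from `b'' = 12 b⁵`. -/
theorem X_mul_SC_three_eq_derivative :
    C 12 * (X * SC 3) = C 12 * (1 - X - X ^ 2)
      - (X ^ 0 * derivative ℚ (derivative ℚ centralBinomSeries)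
        - C 11 * (X ^ 1 * derivative ℚ (derivative ℚ centralBinomSeries))
        + C 39 * (X ^ 2 * derivative ℚ (derivative ℚ centralBinomSeries))
        - C 40 * (X ^ 3 * derivative ℚ (derivative ℚ centralBinomSeries))
        - C 22 * (X ^ 4 * derivative ℚ (derivative ℚ centralBinomSeries))) := by
  have h := X_mul_SC_three
  have hP : (polyP : PowerSeries ℚ) = (1 - 4 * X) ^ 3 * (1 - X - X ^ 2) := by
    rw [coe_polyP]; ring
  rw [hP, coe_polyQ, ← sqrtOneSubFourX_sq] at h
  rw [derivative_derivative_centralBinomSeries]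
  simp only [map_ofNat]
  have h1 := sqrtOneSubFourX_mul_centralBinomSeries
  set s := sqrtOneSubFourX
  set b := centralBinomSeries
  have h6 : s ^ 6 * b ^ 6 = 1 := by rw [← mul_pow, h1, one_pow]
  linear_combination 12 * b ^ 6 * h + 12 * (1 - X - X ^ 2 - X * SC 3) * h6 -
    12 * (1 - 11 * X + 39 * X ^ 2 - 40 * X ^ 3 - 22 * X ^ 4) * b ^ 5 * h1

theorem coeff_X_pow_mul_derivative_derivative (f : PowerSeries ℚ) (k n : ℕ) :
    coeff (n + k) (X ^ k * derivative ℚ (derivative ℚ f)) =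
      coeff (n + 2) f * (n + 2) * (n + 1) := by
  rw [coeff_X_pow_mul, coeff_derivative, coeff_derivative]
  push_cast
  ring

theorem sc_three_eq (m : ℕ) :
    12 * (sc 3 (DyckPath (m + 2)) : ℚ) =
      -((m + 5).centralBinom * (m + 5) * (m + 4) - 11 * ((m + 4).centralBinom * (m + 4) * (m + 3))
        + 39 * ((m + 3).centralBinom * (m + 3) * (m + 2))
        - 40 * ((m + 2).centralBinom * (m + 2) * (m + 1))
        - 22 * ((m + 1).centralBinom * (m + 1) * m)) := by
  -- The factor `X` shifts the index `m + 2` to `m + 3`, beyond the degree of `1 - X - X²`; this is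
  -- where `n ≥ 2` matters.
  have h := congrArg (coeff (R := ℚ) (m + 3)) X_mul_SC_three_eq_derivative
  have h4 : coeff (R := ℚ) (m + 3) (X ^ 4 * derivative ℚ (derivative ℚ centralBinomSeries)) =
      (m + 1).centralBinom * (m + 1) * m := by
    -- For `m = 0` the index is below 4 and the coefficient is zero, in agreement with the factor
    -- `m`.
    rcases m with _ | m
    · simp [coeff_X_pow_mul']
    · rw [coeff_X_pow_mul_derivative_derivative _ 4 m, centralBinomSeries, coeff_mk]
      push_cast
      ring
  have hX : coeff (m + 3) (1 : PowerSeries ℚ) - coeff (m + 3) (X : PowerSeries ℚ)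
      - coeff (m + 3) (X ^ 2 : PowerSeries ℚ) = 0 := by
    simp [coeff_one, coeff_X, coeff_X_pow]
  simp only [map_sub, map_add, coeff_C_mul, h4] at h
  rw [hX, coeff_X_pow_mul_derivative_derivative _ 0 (m + 3),
    coeff_X_pow_mul_derivative_derivative _ 1 (m + 2),
    coeff_X_pow_mul_derivative_derivative _ 2 (m + 1),
    coeff_X_pow_mul_derivative_derivative _ 3 m, coeff_succ_X_mul (m + 2)] at h
  simp only [SC, centralBinomSeries, coeff_mk, add_assoc] at h
  norm_num at h
  linear_combination h

theorem cast_centralBinom_succ (n : ℕ) :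
    ((n + 1).centralBinom : ℚ) = 2 * (2 * n + 1) / (n + 1) * n.centralBinom := by
  have h : ((n : ℚ) + 1) * (n + 1).centralBinom = 2 * (2 * n + 1) * n.centralBinom := by
    exact_mod_cast Nat.succ_mul_centralBinom_succ n
  have : (n : ℚ) + 1 ≠ 0 := by positivity
  field_simp
  linear_combination h

theorem mainTheorem3 :
    polyP = (1 - 4 * Polynomial.X) ^ 3 * (1 - Polynomial.X - Polynomial.X ^ 2) ∧
    ((SC 3 : PowerSeries ℚ) : LaurentSeries ℚ) =
      (((polyP : PowerSeries ℚ) : LaurentSeries ℚ)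
          - ((polyQ : PowerSeries ℚ) : LaurentSeries ℚ) *
            ((sqrtOneSubFourX : PowerSeries ℚ) : LaurentSeries ℚ)) /
        ((PowerSeries.X * (1 - 4 * PowerSeries.X) ^ 3 : PowerSeries ℚ) : LaurentSeries ℚ) ∧
    ∀ n : ℕ, 2 ≤ n →
      (sc 3 (DyckPath n) : ℚ) =
        ((2 * n).choose n : ℚ) *
          ((((n : ℚ) ^ 3 - 7 * (n : ℚ) + 2) * ((n : ℚ) - 2)) /
            (4 * ((n : ℚ) + 1) * (2 * (n : ℚ) - 1))) := by
  refine ⟨polyP_eq, ?_, fun n hn => ?_⟩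
  · have h0 : (X * (1 - 4 * X) ^ 3 : PowerSeries ℚ) ≠ 0 := by
      refine mul_ne_zero X_ne_zero (pow_ne_zero _ fun h => ?_)
      simpa using congrArg constantCoeff h
    rw [eq_div_iff ((map_ne_zero_iff _ HahnSeries.ofPowerSeries_injective).2 h0), ← map_mul,
      ← map_mul, ← map_sub, mul_comm, X_mul_SC_three]
  · obtain ⟨m, rfl⟩ := Nat.exists_eq_add_of_le' hn
    have h := sc_three_eq m
    -- All central binomials are reduced to that of `m + 1`, leaving a rational identity in `m`.
    rw [cast_centralBinom_succ (m + 4), cast_centralBinom_succ (m + 3),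
      cast_centralBinom_succ (m + 2)] at h
    rw [← Nat.centralBinom_eq_two_mul_choose]
    rw [cast_centralBinom_succ (m + 1)] at h ⊢
    push_cast at h ⊢
    have h12 : (12 : ℚ) ≠ 0 := by norm_num
    apply mul_left_cancel₀ h12
    rw [h]
    have h1 : (2 * ((m : ℚ) + 2) - 1) ≠ 0 := by
      have : (0 : ℚ) ≤ m := m.cast_nonneg
      intro h
      linarith
    field_simp
    ring
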